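/- Conventions: all rings are commutative and Noetherian and all modules are finitely generated. For a ring $A$, $\operatorname{CM}(A)$ is the class of maximal Cohen–Macaulay $A$-modules, i.e. modules $M$ with $\operatorname{depth}_{A_{\mathfrak m}} M_{\mathfrak m}\ge \dim A_{\mathfrak m}$ for every maximal ideal $\mathfrak m$ (the zero module is included); $\operatorname{refl}(A)$ is the class of reflexive $A$-modules; $\Omega\operatorname{CM}(A)$ is the class of $A$-modules $M$ for which there is an exact sequence $0\to M\to P\to N\to 0$ with $P$ projective and $N\in\operatorname{CM}(A)$; $\operatorname{tr}_A(M)=\sum_{f\in \operatorname{Hom}_A(M,A)} f(M)$. An ideal $I$ of $A$ is stable if it contains a non-zero-divisor and $I\cong\operatorname{Hom}_A(I,I)$ as $A$-modules. $A$ is generically Gorenstein if $A_{\mathfrak p}$ is Gorenstein for every associated prime $\mathfrak p$ of $A$. Theorem. Let $R$ be a generically Gorenstein Cohen–Macaulay local ring of dimension $1$ with total ring of fractions $Q(R)$, and let $R\subseteq S\subseteq Q(R)$ be a ring extension such that $S$ is a finitely generated $R$-module. Let $\mathfrak c_R(S)=\{a\in Q(R): aS\subseteq R\}$, which is an ideal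 of $R$. Then the following are equivalent: (1) $\Omega\operatorname{CM}(S)=\operatorname{CM}(S)\cap\Omega\operatorname{CM}(R)$, i.e. an $S$-module $M$ is in $\Omega\operatorname{CM}(S)$ if and only if it is in $\operatorname{CM}(S)$ and, as an $R$-module, in $\Omega\operatorname{CM}(R)$; (2) $S\cong\operatorname{Hom}_R(S,R)$ as $R$-modules; (3) $S\in\operatorname{refl}(R)$, and $\mathfrak c_R(S)$ is a stable ideal of $R$; (4) $\Omega\operatorname{CM}(S)=\{M\in\operatorname{refl}(R):\operatorname{tr}_R(M)\subseteq\mathfrak c_R(S)\}$ as classes of $R$-modules, i.e. an $R$-module $M$ is reflexive over $R$ with $\operatorname{tr}_R(M)\subseteq\mathfrak c_R(S)$ if and only if its $R$-module structure extends to an $S$-module structure for which $M\in\Omega\operatorname{CM}(S)$; (5) $\operatorname{refl}(S)=\operatorname{CM}(S)\cap\operatorname{refl}(R)$, i.e. an $S$-module $M$ is in $\operatorname{refl}(S)$ if and only if it is in $\operatorname{CM}(S)$ and, as an $R$-module, in $\operatorname{refl}(R)$. Moreover, $\Omega\operatorname{CM}(R)=\operatorname{refl}(R)$ and $\Omega\operatorname{CM}(S)=\operatorname{refl}(S)$.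 -/

import Mathlib

universe u

/-- A module `M` over a local ring `A` has depth at least `dim A`: some sequence of `dim A` elements
of the maximal ideal is weakly `M`-regular. For a finitely generated nonzero `M` weak regularity is
regularity by Nakayama's lemma; the zero module has infinite depth and is included. -/
def HasMaximalDepth (A : Type u) [CommRing A] [IsLocalRing A] (M : Type u) [AddCommGroup M]
    [Module A M] : Prop :=
  ∃ rs : List A, (∀ r ∈ rs, r ∈ IsLocalRing.maximalIdeal A) ∧
    RingTheory.Sequence.IsWeaklyRegular M rs ∧ (rs.length : WithBot ℕ∞) = ringKrullDim A

/-- A local ring is Cohen–Macaulay if it is Noetherian and its depth equals its dimension. -/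
def IsCohenMacaulayLocal (A : Type u) [CommRing A] [IsLocalRing A] : Prop :=
  IsNoetherianRing A ∧ HasMaximalDepth A A

/-- A ring is Gorenstein, in the sense used for Noetherian local rings: it has finite injective
dimension as a module over itself. -/
def IsGorensteinLocal (A : Type u) [CommRing A] : Prop :=
  ∃ n : ℕ, CategoryTheory.HasInjectiveDimensionLE (ModuleCat.of A A) n

/-- The localizations at all associated primes of the ring are Gorenstein. -/
def IsGenericallyGorenstein (A : Type u) [CommRing A] : Prop :=
  ∀ (p : Ideal A) [p.IsPrime], p ∈ associatedPrimes A A →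
    IsGorensteinLocal (Localization.AtPrime p)

/-- `M ∈ CM(A)`: `M` is finitely generated and `depth M_𝔪 ≥ dim A_𝔪` for all maximal ideals `𝔪`. -/
def IsMCM (A : Type u) [CommRing A] (M : Type u) [AddCommGroup M] [Module A M] : Prop :=
  Module.Finite A M ∧ ∀ (m : Ideal A) [m.IsMaximal],
    HasMaximalDepth (Localization.AtPrime m) (LocalizedModule m.primeCompl M)

/-- `M ∈ ΩCM(A)`: there is an exact sequence `0 → M → P → N → 0` with `P` finitely generated
projective and `N ∈ CM(A)`. -/
def IsSyzygyMCM (A : Type u) [CommRing A] (M : Type u) [AddCommGroup M] [Module A M] : Prop :=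
  Module.Finite A M ∧
    ∃ (P N : Type u) (_ : AddCommGroup P) (_ : Module A P) (_ : AddCommGroup N) (_ : Module A N)
      (f : M →ₗ[A] P) (g : P →ₗ[A] N),
      Module.Finite A P ∧ Module.Projective A P ∧ IsMCM A N ∧
        Function.Injective f ∧ Function.Exact f g ∧ Function.Surjective g

/-- `M ∈ refl(A)`: `M` is finitely generated and the canonical map to its bidual is bijective. -/
def IsReflModule (A : Type u) [CommRing A] (M : Type u) [AddCommGroup M] [Module A M] : Prop :=
  Module.Finite A M ∧ Module.IsReflexive A M

/-- The trace ideal: the sum of the images of all linear maps `M → A`. -/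
def moduleTrace (A : Type u) [CommRing A] (M : Type u) [AddCommGroup M] [Module A M] : Ideal A :=
  ⨆ f : Module.Dual A M, LinearMap.range f

/-- The conductor `(R :_Q S) = {a ∈ Q | a S ⊆ R}`, viewed as an ideal of `R`
(it lies in the image of `R` in `Q` because `1 ∈ S`). -/
def birationalConductor {R Q : Type u} [CommRing R] [CommRing Q] [Algebra R Q]
    (S : Subalgebra R Q) : Ideal R :=
  Submodule.comap (Algebra.linearMap R Q) ((1 : Submodule R Q) / Subalgebra.toSubmodule S)

/-- A stable ideal: it contains a non-zero-divisor and `I ≅ Hom_A(I, I)`. -/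
def IsStableIdeal {A : Type u} [CommRing A] (I : Ideal A) : Prop :=
  (∃ x ∈ I, x ∈ nonZeroDivisors A) ∧ Nonempty (I ≃ₗ[A] (I →ₗ[A] I))

/-! Write `C` for the conductor of `S` inside `Q`. Two facts carry the proof.

Because `R` is generically Gorenstein, `Q` is self-injective. A linear form on a submodule of a
finite module therefore extends to the whole module after multiplication by a non-zero-divisor, and
linear forms separate the points of a torsion-free finite module. In dimension one, maximal
Cohen–Macaulay means finite and torsion-free, so syzygies of such modules are exactly the reflexive
modules. The same holds over `S`, which has the same total ring of fractions, and (1) turns into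
(5).

Evaluation at 1 identifies `Hom_R(S, R)` with `C`, so (2) says `S ≅ C`. Then the image `t` of 1 is a
form for which `f ↦ t ∘ f` identifies `Hom_S(M, S)` with `Hom_R(M, R)`. Reflexivity over `S` and
over `R` thus agree, which gives (5). It also gives (4), since a reflexive module with trace in the
conductor carries an `S`-structure. When `S` is reflexive over `R`, `S = End_R(C)`, and this links
(2) with (3).

Conversely, (4) or (5), tested on `S` and then on `C`, makes `S` reflexive over `R` and `C`
reflexive over `S`. This forces `C` to be invertible (`conductor_mul_eq_one`), hence principal
because `S` is semilocal, so `S ≅ C`. -/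

open scoped nonZeroDivisors

/-! ### Artinian local Gorenstein rings are self-injective. -/

section SelfInjective

open CategoryTheory Abelian

/-- The maximal ideal is the annihilator of some socle element `s`, so the residue field embeds in
`A`. A vector space over it then embeds, basis vector by basis vector, in a free `A`-module. -/
lemma exists_injective_finsupp_of_maximalIdeal_smul_eq_zero {A : Type u} [CommRing A]
    [IsLocalRing A] [IsArtinianRing A] (Y : Type u) [AddCommGroup Y] [Module A Y]
    (hY : ∀ r ∈ IsLocalRing.maximalIdeal A, ∀ y : Y, r • y = 0) :
    ∃ (ι : Type u) (f : Y →ₗ[A] (ι →₀ A)), Function.Injective f := by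
  let m := IsLocalRing.maximalIdeal A
  obtain ⟨p, hp⟩ := associatedPrimes.nonempty A A
  have hpp : p.IsPrime := IsAssociatedPrime.isPrime hp
  have hpm : p = m := IsLocalRing.eq_maximalIdeal inferInstance
  obtain ⟨-, s, hs⟩ := (isAssociatedPrime_iff).1 hp
  have hs' : ∀ r, r ∈ m ↔ r * s = 0 := fun r => by
    rw [← hpm, hs]; simp [Submodule.mem_colon_singleton]
  let _ : Field (A ⧸ m) := Ideal.Quotient.field m
  have htor : Module.IsTorsionBySet A Y (m : Set A) := fun y r => hY r.1 r.2 y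
  let _ : Module (A ⧸ m) Y := htor.module
  have : IsScalarTower A (A ⧸ m) Y := htor.isScalarTower
  let b := Module.Basis.ofVectorSpace (A ⧸ m) Y
  let g : (A ⧸ m) →ₗ[A] A := Submodule.liftQ m (LinearMap.toSpanSingleton A A s)
    (fun r hr => by simpa using (hs' r).1 hr)
  have hg : Function.Injective g := by
    rw [← LinearMap.ker_eq_bot, Submodule.ker_liftQ_eq_bot']
    ext r; rw [hs' r, LinearMap.mem_ker]; simp
  refine ⟨_, Finsupp.mapRange.linearMap g ∘ₗ b.repr.toLinearMap.restrictScalars A, ?_⟩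
  exact (Finsupp.mapRange_injective _ (map_zero g) hg).comp b.repr.injective

/-- Over an Artinian local ring `A`, a positive bound on the injective dimension of `A` can be
lowered. -/
lemma hasInjectiveDimensionLT_of_isArtinianRing {A : Type u} [CommRing A] [IsLocalRing A]
    [IsArtinianRing A] (n : ℕ) (h : HasInjectiveDimensionLT (ModuleCat.of A A) (n + 2)) :
    HasInjectiveDimensionLT (ModuleCat.of A A) (n + 1) := by
  apply hasInjectiveDimensionLT_of_enoughProjectives.{u}
  -- Dévissage along powers of the maximal ideal `m`. By induction a class on `Y` dies on `mY`,
  -- hence comes from `Y/mY`. The latter embeds in a free module `F`, and vanishing of `Ext^(n+2)`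
  -- on the cokernel extends the class to `F`, where it is zero because `n + 1 > 0`.
  have key : ∀ (k : ℕ) (Y : ModuleCat.{u} A),
      (∀ r ∈ IsLocalRing.maximalIdeal A ^ k, ∀ y : Y, r • y = 0) →
      ∀ e : Ext.{u} Y (ModuleCat.of A A) (n + 1), e = 0 := by
    intro k
    induction k with
    | zero =>
      intro Y hY e
      have : Subsingleton Y := ⟨fun a b => by
        rw [← one_smul A a, ← one_smul A b, hY 1 (by simp) a, hY 1 (by simp) b]⟩
      have hz := ModuleCat.isZero_of_subsingleton Y
      rw [← e.mk₀_id_comp, hz.eq_zero_of_src (𝟙 Y), Ext.mk₀_zero, Ext.zero_comp]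
    | succ k ih =>
      intro Y hY e
      let K : Submodule A Y := IsLocalRing.maximalIdeal A • ⊤
      let T : ShortComplex (ModuleCat.{u} A) :=
        ShortComplex.mk (ModuleCat.ofHom K.subtype) (ModuleCat.ofHom K.mkQ)
          (ModuleCat.hom_ext (LinearMap.ext fun z => (Submodule.Quotient.mk_eq_zero K).2 z.2))
      have hT : T.ShortExact := by
        have : Mono T.f := (ModuleCat.mono_iff_injective _).2 K.injective_subtype
        have : Epi T.g := (ModuleCat.epi_iff_surjective _).2 K.mkQ_surjective
        refine ⟨(ShortComplex.moduleCat_exact_iff _).2 fun z hz => ?_⟩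
        exact ⟨⟨z, (Submodule.Quotient.mk_eq_zero K).1 hz⟩, rfl⟩
      have hK : ∀ r ∈ IsLocalRing.maximalIdeal A ^ k, ∀ z : K, r • z = 0 := by
        intro r hr z
        have : ∀ y ∈ K, r • y = 0 := by
          intro y hy
          induction hy using Submodule.smul_induction_on' with
          | smul a ha y hy =>
            rw [smul_smul]; exact hY _ (by rw [pow_succ]; exact Ideal.mul_mem_mul hr ha) y
          | add a _ b _ h1 h2 => rw [smul_add, h1, h2, add_zero]
        exact Subtype.ext (this z.1 z.2)
      obtain ⟨e', rfl⟩ := Ext.contravariant_sequence_exact₂ hT _ e (ih _ hK _)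
      suffices e' = 0 by rw [this, Ext.comp_zero]
      obtain ⟨ι, f, hf⟩ := exists_injective_finsupp_of_maximalIdeal_smul_eq_zero (A := A)
        (Y ⧸ K) (fun r hr y => by
          obtain ⟨y, rfl⟩ := K.mkQ_surjective y
          rw [← map_smul]
          exact (Submodule.Quotient.mk_eq_zero K).2 (Submodule.smul_mem_smul hr trivial))
      let L := LinearMap.range f
      let T' : ShortComplex (ModuleCat.{u} A) := ShortComplex.mk (ModuleCat.ofHom f)
        (ModuleCat.ofHom L.mkQ) (ModuleCat.hom_ext
          (LinearMap.ext fun z => (Submodule.Quotient.mk_eq_zero L).2 ⟨z, rfl⟩))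
      have hT' : T'.ShortExact := by
        have : Mono T'.f := (ModuleCat.mono_iff_injective _).2 hf
        have : Epi T'.g := (ModuleCat.epi_iff_surjective _).2 L.mkQ_surjective
        refine ⟨(ShortComplex.moduleCat_exact_iff _).2 fun z hz => ?_⟩
        exact (Submodule.Quotient.mk_eq_zero L).1 hz
      obtain ⟨e'', rfl⟩ := Ext.contravariant_sequence_exact₁ hT' _ e' (add_comm 1 _)
        (Ext.eq_zero_of_hasInjectiveDimensionLT _ (n + 2) le_rfl)
      have : Projective T'.X₂ := by
        change Projective (ModuleCat.of A (ι →₀ A))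
        infer_instance
      rw [e''.eq_zero_of_projective, Ext.comp_zero]
  obtain ⟨k, hk⟩ := (isArtinianRing_iff_isNilpotent_maximalIdeal A).mp inferInstance
  intro Y
  have : ∀ e : Ext.{u} Y (ModuleCat.of A A) (n + 1), e = 0 := key k Y (fun r hr y => by
    rw [hk] at hr
    rw [show r = 0 by simpa using hr, zero_smul])
  exact ⟨fun a b => by rw [this a, this b]⟩

theorem IsGorensteinLocal.injective_of_isArtinianRing {A : Type u} [CommRing A] [IsLocalRing A]
    [IsArtinianRing A] (h : IsGorensteinLocal A) : Module.Injective A A := by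
  obtain ⟨n, hn⟩ := h
  have : HasInjectiveDimensionLT (ModuleCat.of A A) 1 := by
    unfold HasInjectiveDimensionLE at hn
    induction n with
    | zero => exact hn
    | succ n ih => exact ih (hasInjectiveDimensionLT_of_isArtinianRing n hn)
  have := injective_iff_hasInjectiveDimensionLT_one.2 this
  exact Module.injective_module_of_injective_object A A

end SelfInjective

/-! ### One-dimensional parameters and the Cohen–Macaulay condition. -/

/-- `x` is a non-zero-divisor of the Noetherian ring `A`, and the primes containing `x` are exactly
the maximal ideals. -/
structure IsOneDimParam (A : Type u) [CommRing A] (x : A) : Prop where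
  isNoetherianRing : IsNoetherianRing A
  mem_nonZeroDivisors : x ∈ nonZeroDivisors A
  mem_of_isMaximal : ∀ n : Ideal A, n.IsMaximal → x ∈ n
  isMaximal_of_mem : ∀ q : Ideal A, q.IsPrime → x ∈ q → q.IsMaximal

namespace IsOneDimParam

variable {A : Type u} [CommRing A] {x : A}

lemma notMem_of_mem_minimalPrimes (h : IsOneDimParam A x) {p : Ideal A}
    (hp : p ∈ minimalPrimes A) : x ∉ p := fun hx =>
  (Ideal.disjoint_nonZeroDivisors_of_mem_minimalPrimes hp).le_bot ⟨hx, h.mem_nonZeroDivisors⟩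

lemma mem_minimalPrimes_span (h : IsOneDimParam A x) (n : Ideal A) [hn : n.IsMaximal] :
    n ∈ (Ideal.span {x}).minimalPrimes := by
  refine ⟨⟨hn.isPrime, (Ideal.span_singleton_le_iff_mem _).2 (h.mem_of_isMaximal n hn)⟩,
    fun q hq hqn => ?_⟩
  have := h.isMaximal_of_mem q hq.1 ((Ideal.span_singleton_le_iff_mem _).1 hq.2)
  exact (this.eq_of_le hn.ne_top hqn).ge

lemma height_eq_one (h : IsOneDimParam A x) (n : Ideal A) [hn : n.IsMaximal] : n.height = 1 := by
  have := h.isNoetherianRing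
  refine le_antisymm
    (Ideal.height_le_one_of_isPrincipal_of_mem_minimalPrimes (Ideal.span {x}) n
      (h.mem_minimalPrimes_span n)) ?_
  rw [Order.one_le_iff_ne_zero, Ne, Ideal.height_eq_zero_iff]
  exact fun hmin => h.notMem_of_mem_minimalPrimes hmin (h.mem_of_isMaximal n hn)

lemma ringKrullDim_localization (h : IsOneDimParam A x) (n : Ideal A) [hn : n.IsMaximal] :
    ringKrullDim (Localization.AtPrime n) = 1 := by
  rw [IsLocalization.AtPrime.ringKrullDim_eq_height n, h.height_eq_one n]; rfl

lemma mem_minimalPrimes_of_notMem (h : IsOneDimParam A x) {p : Ideal A} [hp : p.IsPrime]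
    (hx : x ∉ p) : p ∈ minimalPrimes A := by
  have := h.isNoetherianRing
  obtain ⟨n, hn, hpn⟩ := Ideal.exists_le_maximal p hp.ne_top
  have hlt : p < n := lt_of_le_of_ne hpn fun e => hx (e ▸ h.mem_of_isMaximal n hn)
  rw [← Ideal.height_eq_zero_iff, ← Order.lt_one_iff, ← h.height_eq_one n]
  exact Ideal.height_strict_mono_of_isPrime_of_isPrime hlt

lemma mem_associatedPrimes_of_notMem (h : IsOneDimParam A x) {p : Ideal A} [hp : p.IsPrime]
    (hx : x ∉ p) : p ∈ associatedPrimes A A := by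
  have := h.isNoetherianRing
  apply Module.associatedPrimes.minimalPrimes_annihilator_subset_associatedPrimes A A
  have : Module.annihilator A A = ⊥ := (Module.annihilator_eq_bot).2 inferInstance
  rw [this]
  exact h.mem_minimalPrimes_of_notMem hx

/-- A module is maximal Cohen–Macaulay if and only if it is finite and the parameter is regular. -/
theorem isMCM_iff (h : IsOneDimParam A x) (M : Type u) [AddCommGroup M] [Module A M] :
    IsMCM A M ↔ Module.Finite A M ∧ IsSMulRegular M x := by
  have := h.isNoetherianRing
  refine and_congr_right fun _ => ⟨fun H => ?_, fun H n hn => ?_⟩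
  · rw [isSMulRegular_iff_right_eq_zero_of_smul]
    intro z hz
    refine Module.eq_zero_of_localization_maximal
      (R := A) (fun (n : Ideal A) _ => LocalizedModule n.primeCompl M)
      (fun (n : Ideal A) _ => LocalizedModule.mkLinearMap n.primeCompl M) z
      (fun n hn => ?_)
    obtain ⟨rs, hmem, hreg, hlen⟩ := H n
    rw [h.ringKrullDim_localization n] at hlen
    obtain ⟨r, rfl⟩ := List.length_eq_one_iff.1 (by exact_mod_cast hlen)
    rw [RingTheory.Sequence.isWeaklyRegular_singleton_iff] at hreg
    let B := Localization.AtPrime n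
    -- Only the maximal ideal of the localization contains `x`, so a power of the regular element
    -- `r` is a multiple of `x`. Whatever `x` kills is then killed by that power.
    have hrad : r ∈ (Ideal.span {algebraMap A B x}).radical := by
      rw [Ideal.radical_eq_sInf, Submodule.mem_sInf]
      rintro (P : Ideal B) ⟨hP, hPp⟩
      have hx : x ∈ P.under A := hP (Ideal.mem_span_singleton_self _)
      have h1 := h.isMaximal_of_mem _ (hPp.under A) hx
      have h2 : P.under A ≤ n :=
        (Ideal.comap_mono (IsLocalRing.le_maximalIdeal hPp.ne_top)).trans
          (IsLocalization.AtPrime.under_maximalIdeal B n).le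
      have h4 : P = IsLocalRing.maximalIdeal B :=
        Localization.AtPrime.eq_maximalIdeal_iff_under_eq.1 (h1.eq_of_le hn.ne_top h2)
      rw [h4]; exact hmem r (by simp)
    obtain ⟨k, hk⟩ := hrad
    obtain ⟨c, hc⟩ := Ideal.mem_span_singleton'.1 hk
    have hz' : r ^ k • LocalizedModule.mkLinearMap n.primeCompl M z = 0 := by
      rw [← hc, mul_smul, algebraMap_smul, ← map_smul, hz, map_zero, smul_zero]
    exact (hreg.pow k).right_eq_zero_of_smul hz'
  · refine ⟨[algebraMap A _ x], ?_, ?_, ?_⟩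
    · intro r hr
      rw [List.mem_singleton.1 hr]
      have := h.mem_of_isMaximal n hn
      rwa [← IsLocalization.AtPrime.under_maximalIdeal (Localization.AtPrime n) n] at this
    · rw [RingTheory.Sequence.isWeaklyRegular_singleton_iff]
      have := H.of_isLocalizedModule (Localization.AtPrime n) n.primeCompl
        (LocalizedModule.mkLinearMap n.primeCompl M)
      exact this
    · rw [h.ringKrullDim_localization n]; rfl

end IsOneDimParam

/-- A one-dimensional Cohen–Macaulay local ring has a parameter. -/
lemma IsCohenMacaulayLocal.exists_isOneDimParam {R : Type u} [CommRing R] [IsLocalRing R]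
    (hCM : IsCohenMacaulayLocal R) (hdim : ringKrullDim R = 1) : ∃ x : R, IsOneDimParam R x := by
  obtain ⟨hN, rs, hmem, hreg, hlen⟩ := hCM
  rw [hdim] at hlen
  obtain ⟨r, rfl⟩ := List.length_eq_one_iff.1 (by exact_mod_cast hlen)
  rw [RingTheory.Sequence.isWeaklyRegular_singleton_iff] at hreg
  have hr : r ∈ nonZeroDivisors R := by
    rw [mem_nonZeroDivisors_iff_right]
    exact fun z hz => hreg.right_eq_zero_of_smul (by rwa [smul_eq_mul, mul_comm])
  have hdim' : Ring.KrullDimLE 1 R := by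
    rw [Ring.krullDimLE_iff, hdim]; rfl
  refine ⟨r, hN, hr, fun n hn => ?_, fun q hq hrq => ?_⟩
  · rw [IsLocalRing.eq_maximalIdeal hn]; exact hmem r (by simp)
  · rcases (Ring.krullDimLE_one_iff.1 hdim') q hq with hm | hm
    · exact ((Ideal.disjoint_nonZeroDivisors_of_mem_minimalPrimes hm).le_bot ⟨hrq, hr⟩).elim
    · exact hm

/-- Maximal ideals correspond to maximal ideals under contraction along an integral extension. This
passes the parameter from `R` to `S`, which need not be local. -/
lemma IsOneDimParam.of_integral {A B : Type u} [CommRing A] [CommRing B] [Algebra A B]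
    [Module.Finite A B] {x : A} (h : IsOneDimParam A x)
    (hx : algebraMap A B x ∈ nonZeroDivisors B) : IsOneDimParam B (algebraMap A B x) where
  isNoetherianRing := by
    have := h.isNoetherianRing
    exact IsNoetherianRing.of_finite A B
  mem_nonZeroDivisors := hx
  mem_of_isMaximal n hn := by
    have : (n.comap (algebraMap A B)).IsMaximal :=
      Ideal.isMaximal_comap_of_isIntegral_of_isMaximal n
    exact h.mem_of_isMaximal _ this
  isMaximal_of_mem q hq hxq :=
    Ideal.isMaximal_of_isIntegral_of_isMaximal_comap q
      (h.isMaximal_of_mem _ (hq.comap _) hxq)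

/-! ### Self-injectivity of the total ring of fractions, and clearing denominators. -/

/-- The total ring of fractions of a generically Gorenstein ring with a parameter is
self-injective. -/
theorem IsOneDimParam.injective_fractionRing {A Q : Type u} [CommRing A] [CommRing Q] [Algebra A Q]
    [IsFractionRing A Q] {x : A} (h : IsOneDimParam A x) (hG : IsGenericallyGorenstein A) :
    Module.Injective Q Q := by
  have := h.isNoetherianRing
  have : IsNoetherianRing Q := IsLocalization.isNoetherianRing A⁰ Q inferInstance
  -- Injectivity is checked at each maximal ideal `P` of `Q`. Since `x` is a unit in `Q`, `P` lies
  -- over a prime `p` missing `x`, which is minimal and associated. Thus `A_p ≅ Q_P` is Artinian and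
  -- Gorenstein.
  refine Module.injective_of_localization_maximal' (R := Q) (M := Q)
    (fun (P : Ideal Q) _ => Localization.AtPrime P) (fun (P : Ideal Q) _ => Localization.AtPrime P)
    (fun (P : Ideal Q) _ => Algebra.linearMap Q (Localization.AtPrime P)) fun P hP => ?_
  let p : Ideal A := P.comap (algebraMap A Q)
  have hp : p.IsPrime := hP.isPrime.comap _
  have hx : x ∉ p := fun hx => hP.ne_top (Ideal.eq_top_of_isUnit_mem _ hx
    (IsLocalization.map_units Q (⟨x, h.mem_nonZeroDivisors⟩ : A⁰)))
  have : IsArtinianRing (Localization.AtPrime p) := by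
    rw [isArtinianRing_iff_isNoetherianRing_krullDimLE_zero]
    refine ⟨inferInstance, ?_⟩
    rw [Ring.krullDimLE_iff, IsLocalization.AtPrime.ringKrullDim_eq_height p,
      Ideal.height_eq_zero_iff.2 (h.mem_minimalPrimes_of_notMem hx)]
    rfl
  have := (hG p (h.mem_associatedPrimes_of_notMem hx)).injective_of_isArtinianRing
  have : IsLocalization.AtPrime (Localization.AtPrime P) p :=
    IsLocalization.isLocalization_isLocalization_atPrime_isLocalization A⁰
      (Localization.AtPrime P) P
  let e : Localization.AtPrime p ≃+* Localization.AtPrime P :=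
    (IsLocalization.algEquiv p.primeCompl (Localization.AtPrime p)
      (Localization.AtPrime P)).toRingEquiv
  exact Module.Injective.of_ringEquiv e e.toSemilinearEquiv

/-- Flatness keeps the inclusion injective after base change to `Q`; the extension found there is
restricted along `y ↦ 1 ⊗ y`. -/
lemma Module.Injective.of_flat {A Q : Type u} [CommRing A] [CommRing Q] [Algebra A Q]
    [Module.Flat A Q] [Module.Injective Q Q] : Module.Injective A Q where
  out X Y _ _ _ _ f hf g := by
    obtain ⟨l, hl⟩ := Module.Injective.out (R := Q) (f.baseChange Q)
      (Module.Flat.lTensor_preserves_injective_linearMap f hf) (g.liftBaseChange Q)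
    refine ⟨(l.restrictScalars A) ∘ₗ TensorProduct.mk A Q Y 1, fun z => ?_⟩
    simpa using hl (1 ⊗ₜ z)

lemma exists_linearMap_of_mem_range {A Q : Type u} [CommRing A] [CommRing Q] [Algebra A Q]
    [IsFractionRing A Q] {M : Type u} [AddCommGroup M] [Module A M] (L : M →ₗ[A] Q)
    (h : ∀ m, ∃ r : A, algebraMap A Q r = L m) :
    ∃ g : M →ₗ[A] A, ∀ m, algebraMap A Q (g m) = L m := by
  have hinj : Function.Injective (Algebra.linearMap A Q) := IsFractionRing.injective A Q
  refine ⟨(LinearEquiv.ofInjective _ hinj).symm.toLinearMap ∘ₗ L.codRestrict _ h, fun z => ?_⟩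
  exact congrArg Subtype.val (LinearEquiv.apply_symm_apply (LinearEquiv.ofInjective _ hinj)
    (L.codRestrict _ h z))

lemma exists_clear_denominators {A Q : Type u} [CommRing A] [CommRing Q] [Algebra A Q]
    [IsFractionRing A Q] {P : Type u} [AddCommGroup P] [Module A P] [Module.Finite A P]
    (g : P →ₗ[A] Q) : ∃ d ∈ A⁰, ∃ g' : P →ₗ[A] A, ∀ z, algebraMap A Q (g' z) = d • g z := by
  classical
  obtain ⟨s, hs⟩ := Module.Finite.fg_top (R := A) (M := P)
  obtain ⟨d, hd⟩ := IsLocalization.exist_integer_multiples_of_finset A⁰ (s.image g)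
  have hmem : ∀ z, ((d : A) • g) z ∈ LinearMap.range (Algebra.linearMap A Q) := by
    intro z
    have hz : z ∈ Submodule.span A (s : Set P) := hs ▸ trivial
    induction hz using Submodule.span_induction with
    | mem z hz =>
      obtain ⟨a, ha⟩ := hd (g z) (Finset.mem_image_of_mem _ hz)
      exact ⟨a, ha⟩
    | zero => simp
    | add a b _ _ h1 h2 => rw [map_add]; exact add_mem h1 h2
    | smul a b _ h1 => rw [map_smul]; exact Submodule.smul_mem _ _ h1
  obtain ⟨g', hg'⟩ := exists_linearMap_of_mem_range _ hmem
  exact ⟨d, d.2, g', hg'⟩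

/-! ### Syzygies of maximal Cohen–Macaulay modules are the reflexive modules. -/

section

variable {A : Type u} (Q : Type u) [CommRing A] [CommRing Q] [Algebra A Q] [IsFractionRing A Q]
  [Module.Injective A Q]
include Q

/-- Injectivity of `Q` extends the form with values in `Q`; finiteness of `P` gives one common
denominator `d`. -/
lemma exists_extend_multiple {M P : Type u} [AddCommGroup M] [Module A M] [AddCommGroup P]
    [Module A P] [Module.Finite A P] (i : M →ₗ[A] P) (hi : Function.Injective i) (f : M →ₗ[A] A) :
    ∃ d ∈ A⁰, ∃ f' : P →ₗ[A] A, ∀ z, f' (i z) = d * f z := by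
  obtain ⟨g, hg⟩ := Module.Injective.out (R := A) i hi (Algebra.linearMap A Q ∘ₗ f)
  obtain ⟨d, hd, f', hf'⟩ := exists_clear_denominators g
  refine ⟨d, hd, f', fun z => IsFractionRing.injective A Q ?_⟩
  rw [hf', hg, map_mul, Algebra.smul_def]; rfl

variable {x : A}

/-- Linear forms separate the points of a torsion-free module. -/
lemma IsOneDimParam.exists_dual_apply_ne_zero (h : IsOneDimParam A x) {N : Type u} [AddCommGroup N]
    [Module A N] [Module.Finite A N] (hN : IsSMulRegular N x) {z : N} (hz : z ≠ 0) :
    ∃ f : N →ₗ[A] A, f z ≠ 0 := by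
  have := h.isNoetherianRing
  -- An associated prime `p` of `N` containing the annihilator of `z` misses `x`, so it is also the
  -- annihilator of some nonzero `a` in `A`. Then `r • z ↦ r * a` is well defined, and a multiple of
  -- it by a non-zero-divisor extends to `N`.
  obtain ⟨p, hp, hle⟩ := exists_le_isAssociatedPrime_of_isNoetherianRing A z hz
  have hpp := hp.isPrime
  obtain ⟨-, w, hw⟩ := isAssociatedPrime_iff.1 hp
  have hx : x ∉ p := by
    intro hx
    rw [hw, Submodule.mem_colon_singleton, Submodule.mem_bot] at hx
    have hw0 := hN.right_eq_zero_of_smul hx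
    refine hpp.ne_top ?_
    rw [hw, hw0, Ideal.eq_top_iff_one]
    simp [Submodule.mem_colon_singleton]
  obtain ⟨-, a, ha⟩ := isAssociatedPrime_iff.1 (h.mem_associatedPrimes_of_notMem hx)
  have ha0 : a ≠ 0 := by
    rintro rfl
    refine hpp.ne_top ?_
    rw [ha, Ideal.eq_top_iff_one]
    simp [Submodule.mem_colon_singleton]
  let t := LinearMap.toSpanSingleton A N z
  let g : (A ⧸ LinearMap.ker t) →ₗ[A] A := Submodule.liftQ _ (LinearMap.toSpanSingleton A A a) (by
    intro r hr
    have : r ∈ p := hle (by simpa [t, Submodule.mem_colon_singleton] using hr)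
    rw [ha, Submodule.mem_colon_singleton] at this
    simpa using this)
  let i : (A ⧸ LinearMap.ker t) →ₗ[A] N := Submodule.liftQ _ t le_rfl
  have hi : Function.Injective i := by
    rw [← LinearMap.ker_eq_bot, Submodule.ker_liftQ_eq_bot']; rfl
  obtain ⟨d, hd, f, hf⟩ := exists_extend_multiple Q i hi g
  refine ⟨f, fun hfz => ha0 ?_⟩
  have h1 := hf (Submodule.Quotient.mk 1)
  have h2 : i (Submodule.Quotient.mk 1) = z := one_smul A z
  have h3 : g (Submodule.Quotient.mk 1) = a := one_smul A a
  rw [h2, h3, hfz] at h1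
  exact (mul_left_mem_nonZeroDivisors_eq_zero_iff hd).1 h1.symm

/-- An element `φ` of the bidual of `M` pushes forward to a point `p` of `P`, as `P` is reflexive.
Forms on `N` vanish at the image of `p` and separate points, so `p` lies in `M`. It represents `φ`
because each form on `M` has a regular multiple that extends to `P`. -/
theorem IsOneDimParam.isReflModule_of_isSyzygyMCM (h : IsOneDimParam A x) {M : Type u}
    [AddCommGroup M] [Module A M] (hM : IsSyzygyMCM A M) : IsReflModule A M := by
  obtain ⟨hfin, P, N, _, _, _, _, i, g, _, _, hN, hi, hex, hg⟩ := hM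
  refine ⟨hfin, ⟨⟨?_, fun φ => ?_⟩⟩⟩
  all_goals rw [h.isMCM_iff] at hN; have := hN.1
  · rw [injective_iff_map_eq_zero]
    intro z hz
    apply hi
    rw [map_zero]
    apply (Module.bijective_dual_eval A P).1
    rw [map_zero]
    ext f
    exact LinearMap.congr_fun hz (f ∘ₗ i)
  · obtain ⟨p, hp⟩ := (Module.bijective_dual_eval A P).2 (φ ∘ₗ i.dualMap)
    have hp' : ∀ f : Module.Dual A P, f p = φ (f ∘ₗ i) := fun f => LinearMap.congr_fun hp f
    have hgp : g p = 0 := by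
      by_contra hne
      obtain ⟨f, hf⟩ := h.exists_dual_apply_ne_zero Q hN.2 hne
      apply hf
      have := hp' (f ∘ₗ g)
      rw [LinearMap.comp_assoc, hex.linearMap_comp_eq_zero, LinearMap.comp_zero, map_zero] at this
      exact this
    obtain ⟨z, rfl⟩ := (hex p).1 hgp
    refine ⟨z, LinearMap.ext fun f => ?_⟩
    obtain ⟨d, hd, f', hf'⟩ := exists_extend_multiple Q i hi f
    have h1 := hp' f'
    have h2 : f' ∘ₗ i = d • f := LinearMap.ext hf'
    rw [h2, map_smul, hf', smul_eq_mul] at h1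
    exact (mul_cancel_left_mem_nonZeroDivisors hd).1 h1

end

theorem IsOneDimParam.isSMulRegular_of_isReflexive {A : Type u} [CommRing A] {x : A}
    (h : IsOneDimParam A x) (M : Type u) [AddCommGroup M] [Module A M] [Module.IsReflexive A M] :
    IsSMulRegular M x := by
  rw [isSMulRegular_iff_right_eq_zero_of_smul]
  intro z hz
  apply (Module.bijective_dual_eval A M).1
  rw [map_zero]
  ext f
  have : x * f z = 0 := by rw [← smul_eq_mul, ← map_smul, hz, map_zero]
  exact (mul_left_mem_nonZeroDivisors_eq_zero_iff h.mem_nonZeroDivisors).1 this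

/-- Dualizing a free presentation `0 → K → F → M* → 0` embeds `M = M**` in `F*` with cokernel inside
the torsion-free module `K*`. -/
theorem IsOneDimParam.isSyzygyMCM_of_isReflModule {A : Type u} [CommRing A] {x : A}
    (h : IsOneDimParam A x) {M : Type u} [AddCommGroup M] [Module A M]
    (hM : IsReflModule A M) : IsSyzygyMCM A M := by
  obtain ⟨hfin, hrefl⟩ := hM
  have := h.isNoetherianRing
  obtain ⟨n, π, hπ⟩ := Module.Finite.exists_fin' A (Module.Dual A M)
  let F := Fin n → A
  let ρ : Module.Dual A F →ₗ[A] Module.Dual A (LinearMap.ker π) :=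
    (LinearMap.ker π).subtype.dualMap
  let i : M →ₗ[A] Module.Dual A F := π.dualMap ∘ₗ Module.Dual.eval A M
  refine ⟨hfin, Module.Dual A F, LinearMap.range ρ, inferInstance, inferInstance, inferInstance,
    inferInstance, i, ρ.rangeRestrict,
    inferInstance, inferInstance, ?_, ?_, ?_, ρ.surjective_rangeRestrict⟩
  · rw [h.isMCM_iff]
    refine ⟨inferInstance, ?_⟩
    rw [isSMulRegular_iff_right_eq_zero_of_smul]
    rintro ⟨f, hf⟩ hz
    ext z
    have : x * f z = 0 := LinearMap.congr_fun (congrArg Subtype.val hz) z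
    exact (mul_left_mem_nonZeroDivisors_eq_zero_iff h.mem_nonZeroDivisors).1 this
  · exact (LinearMap.dualMap_injective_of_surjective hπ).comp (Module.bijective_dual_eval A M).1
  · intro f
    constructor
    · intro hf
      have hf' : LinearMap.ker π ≤ LinearMap.ker f := fun z hz =>
        LinearMap.congr_fun (congrArg Subtype.val hf) ⟨z, hz⟩
      let e := π.quotKerEquivOfSurjective hπ
      let φ : Module.Dual A (Module.Dual A M) := (LinearMap.ker π).liftQ f hf' ∘ₗ e.symm.toLinearMap
      obtain ⟨z, hz⟩ := (Module.bijective_dual_eval A M).2 φ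
      refine ⟨z, LinearMap.ext fun w => ?_⟩
      have h1 : e.symm (π w) = Submodule.Quotient.mk w := by
        rw [LinearEquiv.symm_apply_eq]; rfl
      have h2 := LinearMap.congr_fun hz (π w)
      change _ = (LinearMap.ker π).liftQ f hf' (e.symm (π w)) at h2
      rw [h1] at h2
      exact h2
    · rintro ⟨z, rfl⟩
      ext w
      have : π w = 0 := w.2
      change (π w) z = 0
      rw [this]; rfl

theorem IsOneDimParam.isSyzygyMCM_iff_isReflModule {A : Type u} (Q : Type u) [CommRing A]
    [CommRing Q] [Algebra A Q] [IsFractionRing A Q] [Module.Injective Q Q] {x : A}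
    (h : IsOneDimParam A x) (M : Type u) [AddCommGroup M] [Module A M] :
    IsSyzygyMCM A M ↔ IsReflModule A M := by
  have : Module.Flat A Q := IsLocalization.flat Q A⁰
  have : Module.Injective A Q := .of_flat
  exact ⟨h.isReflModule_of_isSyzygyMCM Q, h.isSyzygyMCM_of_isReflModule⟩

/-! ### Comparing duals over `S` and `R` through a nondegenerate form. -/

section TraceForm

variable {R S : Type u} [CommRing R] [CommRing S] [Algebra R S] (t : S →ₗ[R] R)
  (hinj : ∀ s, (∀ u, t (s * u) = 0) → s = 0)
  (hsurj : ∀ f : Module.Dual R S, ∃ s, ∀ u, f u = t (s * u))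
  {M : Type u} [AddCommGroup M] [Module R M] [Module S M] [IsScalarTower R S M]

include hinj

lemma eq_of_traceForm_eq {s s' : S} (h : ∀ u, t (s * u) = t (s' * u)) : s = s' :=
  sub_eq_zero.1 (hinj _ fun u => by rw [sub_mul, map_sub, h, sub_self])

include hsurj

/-- A nondegenerate linear form `t : S → R` identifies `Hom_S(M, S)` with `Hom_R(M, R)`. -/
lemma exists_traceForm_lift (g : M →ₗ[R] R) : ∃ f : M →ₗ[S] S, ∀ m, t (f m) = g m := by
  have hex : ∀ m : M, ∃ s, ∀ u : S, g (u • m) = t (s * u) := fun m =>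
    hsurj (g ∘ₗ (LinearMap.toSpanSingleton S M m).restrictScalars R)
  choose σ hσ using hex
  refine ⟨{ toFun := σ, map_add' := fun a b => ?_, map_smul' := fun s a => ?_ }, fun m => ?_⟩
  · refine eq_of_traceForm_eq t hinj fun u => ?_
    rw [← hσ, smul_add, map_add, add_mul, map_add, hσ, hσ]
  · refine eq_of_traceForm_eq t hinj fun u => ?_
    rw [← hσ, smul_smul, hσ]
    congr 1
    simp only [smul_eq_mul, RingHom.id_apply]; ring
  · have := hσ m 1
    rw [one_smul, mul_one] at this
    exact this.symm

variable (M) in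
/-- Over the base ring and over an extension with a nondegenerate linear form, reflexivity is the
same condition. -/
theorem isReflexive_iff_of_traceForm : Module.IsReflexive S M ↔ Module.IsReflexive R M := by
  have hlift : ∀ {N : Type u} [AddCommGroup N] [Module R N] [Module S N] [IsScalarTower R S N]
      (g : N →ₗ[R] R), ∃ f : N →ₗ[S] S, ∀ m, t (f m) = g m :=
    fun g => exists_traceForm_lift t hinj hsurj g
  have huniq : ∀ {N : Type u} [AddCommGroup N] [Module S N] (f f' : N →ₗ[S] S),
      (∀ m, t (f m) = t (f' m)) → f = f' := fun f f' h => LinearMap.ext fun m =>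
    eq_of_traceForm_eq t hinj fun u => by
      rw [mul_comm, mul_comm (f' m), ← smul_eq_mul, ← smul_eq_mul, ← map_smul, ← map_smul, h]
  let T (f : M →ₗ[S] S) : M →ₗ[R] R := t ∘ₗ f.restrictScalars R
  constructor
  · intro hrefl
    refine ⟨⟨?_, fun φ => ?_⟩⟩
    · rw [injective_iff_map_eq_zero]
      intro m hm
      apply (Module.bijective_dual_eval S M).1
      rw [map_zero]
      refine LinearMap.ext fun f => hinj _ fun u => ?_
      have : t ((u • f) m) = 0 := LinearMap.congr_fun hm (T (u • f))
      rwa [LinearMap.smul_apply, smul_eq_mul, mul_comm] at this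
    · let ψ : Module.Dual S M →ₗ[R] R := φ ∘ₗ
        { toFun := T
          map_add' := fun f f' => LinearMap.ext fun m => map_add t _ _
          map_smul' := fun r f => LinearMap.ext fun m => map_smul t _ _ }
      obtain ⟨Ψ, hΨ⟩ := hlift ψ
      obtain ⟨m, rfl⟩ := (Module.bijective_dual_eval S M).2 Ψ
      refine ⟨m, LinearMap.ext fun g => ?_⟩
      obtain ⟨f, hf⟩ := hlift g
      have hg : g = T f := LinearMap.ext fun m => (hf m).symm
      rw [hg]
      exact hΨ f
  · intro hrefl
    refine ⟨⟨?_, fun ψ => ?_⟩⟩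
    · rw [injective_iff_map_eq_zero]
      intro m hm
      apply (Module.bijective_dual_eval R M).1
      rw [map_zero]
      refine LinearMap.ext fun g => ?_
      obtain ⟨f, hf⟩ := hlift g
      have : f m = 0 := LinearMap.congr_fun hm f
      rw [Module.Dual.eval_apply, ← hf, this, map_zero]; rfl
    -- Lifts along `t` are unique, so the chosen `l` is automatically `R`-linear.
    · choose l hl using fun g : Module.Dual R M => hlift g
      let φ : Module.Dual R (Module.Dual R M) :=
        { toFun := fun g => t (ψ (l g))
          map_add' := fun g g' => by
            have : l (g + g') = l g + l g' := huniq _ _ fun m => by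
              rw [hl, LinearMap.add_apply, LinearMap.add_apply, map_add, hl, hl]
            rw [this, map_add, map_add]
          map_smul' := fun r g => by
            have : l (r • g) = r • l g := huniq _ _ fun m => by
              rw [hl, LinearMap.smul_apply, LinearMap.smul_apply, map_smul, hl]
            rw [this, LinearMap.map_smul_of_tower, map_smul]; rfl }
      obtain ⟨m, hm⟩ := (Module.bijective_dual_eval R M).2 φ
      refine ⟨m, LinearMap.ext fun f => eq_of_traceForm_eq t hinj fun u => ?_⟩
      have h1 : l (T (u • f)) = u • f := huniq _ _ fun m => hl _ m
      have h2 : t ((u • f) m) = t (ψ (l (T (u • f)))) := LinearMap.congr_fun hm (T (u • f))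
      rw [h1, map_smul, LinearMap.smul_apply, smul_eq_mul, smul_eq_mul, mul_comm, mul_comm u] at h2
      exact h2

end TraceForm

/-! ### Modules embedded in the total ring of fractions. -/

section Fractions

variable {A Q : Type u} [CommRing A] [CommRing Q] [Algebra A Q] [IsFractionRing A Q]
  {M : Type u} [AddCommGroup M] [Module A M]

lemma exists_mul_eq_algebraMap (q : Q) :
    ∃ d ∈ A⁰, ∃ a : A, algebraMap A Q d * q = algebraMap A Q a := by
  obtain ⟨⟨a, d⟩, h⟩ := IsLocalization.surj A⁰ q
  exact ⟨d, d.2, a, by rw [mul_comm]; exact h⟩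

lemma isUnit_algebraMap_of_mem_nonZeroDivisors {d : A} (hd : d ∈ A⁰) : IsUnit (algebraMap A Q d) :=
  IsLocalization.map_units Q (⟨d, hd⟩ : A⁰)

/-- A linear map from a submodule of the fraction ring is a multiplication. -/
lemma linearMap_mul_comm_of_injective (j : M →ₗ[A] Q) (hj : Function.Injective j) (f : M →ₗ[A] Q)
    (y z : M) : f y * j z = f z * j y := by
  obtain ⟨d, hd, a, ha⟩ := exists_mul_eq_algebraMap (A := A) (j y)
  obtain ⟨e, he, b, hb⟩ := exists_mul_eq_algebraMap (A := A) (j z)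
  -- With `j y = a/d` and `j z = b/e`, both sides have image `a * b` in `Q`.
  have key : (d * b) • y = (e * a) • z := hj (by
    rw [map_smul, map_smul, Algebra.smul_def, Algebra.smul_def, map_mul, map_mul, ← ha, ← hb]; ring)
  have h2 := congrArg f key
  rw [map_smul, map_smul, Algebra.smul_def, Algebra.smul_def, map_mul, map_mul, ← ha, ← hb] at h2
  have hu : IsUnit (algebraMap A Q d * algebraMap A Q e) :=
    (isUnit_algebraMap_of_mem_nonZeroDivisors hd).mul (isUnit_algebraMap_of_mem_nonZeroDivisors he)
  apply hu.mul_left_cancel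
  linear_combination h2

/-- A reflexive submodule of the fraction ring is the double dual of itself inside the fraction
ring. -/
lemma exists_eq_of_isReflexive [Module.Finite A M] [Module.IsReflexive A M] (j : M →ₗ[A] Q)
    (hj : Function.Injective j) (w : M) (hw : IsUnit (j w)) (a : Q)
    (ha : ∀ y : Q, (∀ m, ∃ r : A, algebraMap A Q r = y * j m) → ∃ r : A, algebraMap A Q r = a * y) :
    ∃ m, j m = a := by
  obtain ⟨u, hu⟩ := hw
  have hfac : ∀ (f : Module.Dual A M) (m : M),
      algebraMap A Q (f m) * u = algebraMap A Q (f w) * j m := fun f m => by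
    rw [hu]; exact linearMap_mul_comm_of_injective j hj (Algebra.linearMap A Q ∘ₗ f) m w
  -- By `hfac` a form `f` is multiplication by `f w / j w`, so `ha` makes `f ↦ a * (f w / j w)` an
  -- `A`-valued element of the bidual. The point `m` representing it is the candidate.
  let L : Module.Dual A M →ₗ[A] Q := LinearMap.mulLeft A (a * ↑u⁻¹) ∘ₗ Algebra.linearMap A Q ∘ₗ
    Module.Dual.eval A M w
  have hL : ∀ f, L f = a * (↑u⁻¹ * algebraMap A Q (f w)) := fun f => mul_assoc _ _ _
  obtain ⟨φ, hφ⟩ := exists_linearMap_of_mem_range L (fun f => by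
    rw [hL]
    refine ha _ fun m => ⟨f m, ?_⟩
    rw [mul_assoc, ← hfac, mul_comm, Units.mul_inv_cancel_right])
  obtain ⟨m, rfl⟩ := (Module.bijective_dual_eval A M).2 φ
  -- Testing on the form `f = d • j` turns the defining equation of `m` into `d * j m = d * a`.
  obtain ⟨d, hd, f, hf⟩ := exists_clear_denominators j
  refine ⟨m, ?_⟩
  have h1 : algebraMap A Q (f m) = a * (↑u⁻¹ * algebraMap A Q (f w)) := (hφ f).trans (hL f)
  rw [hf, hf, ← hu, Algebra.smul_def, Algebra.smul_def] at h1
  apply (isUnit_algebraMap_of_mem_nonZeroDivisors (Q := Q) hd).mul_left_cancel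
  rw [h1, mul_comm (↑u⁻¹ : Q), Units.mul_inv_cancel_right, mul_comm]

end Fractions

lemma IsOneDimParam.finite_isMaximal {A : Type u} [CommRing A] {x : A} (h : IsOneDimParam A x) :
    {n : Ideal A | n.IsMaximal}.Finite := by
  have := h.isNoetherianRing
  exact (Ideal.finite_minimalPrimes_of_isNoetherianRing A (Ideal.span {x})).subset
    fun n hn => by
      have : n.IsMaximal := hn
      exact h.mem_minimalPrimes_span n

/-! ### The conductor of a birational extension. -/

namespace BirationalExtension

variable {R Q : Type u} [CommRing R] [CommRing Q] [Algebra R Q] (S : Subalgebra R Q)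

/-- The conductor `(R :_Q S)` as an `S`-submodule of `Q`. -/
def conductor : Submodule S Q where
  carrier := {a | ∀ s : S, ∃ r : R, algebraMap R Q r = a * s}
  add_mem' := fun {a b} ha hb s => by
    obtain ⟨r, hr⟩ := ha s
    obtain ⟨r', hr'⟩ := hb s
    exact ⟨r + r', by rw [map_add, hr, hr', add_mul]⟩
  zero_mem' := fun s => ⟨0, by rw [map_zero, zero_mul]⟩
  smul_mem' := fun c a ha s => by
    obtain ⟨r, hr⟩ := ha (c * s)
    exact ⟨r, by rw [hr, Subalgebra.smul_def, smul_eq_mul, MulMemClass.coe_mul]; ring⟩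

lemma mem_conductor {a : Q} : a ∈ conductor S ↔ ∀ s : S, ∃ r : R, algebraMap R Q r = a * s :=
  Iff.rfl

lemma exists_algebraMap_eq (a : conductor S) : ∃ r : R, algebraMap R Q r = a := by
  obtain ⟨r, hr⟩ := a.2 1
  exact ⟨r, by rw [hr, OneMemClass.coe_one, mul_one]⟩

lemma mem_birationalConductor {r : R} :
    r ∈ birationalConductor S ↔ algebraMap R Q r ∈ conductor S := by
  rw [birationalConductor, Submodule.mem_comap, Submodule.mem_div_iff_forall_mul_mem, mem_conductor]
  simp only [Submodule.mem_one]
  exact ⟨fun h s => h s s.2, fun h s hs => h ⟨s, hs⟩⟩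

variable [IsFractionRing R Q]

lemma algebraMap_mem_nonZeroDivisors {d : R} (hd : d ∈ R⁰) : algebraMap R S d ∈ S⁰ := by
  rw [mem_nonZeroDivisors_iff_right]
  intro t ht
  apply Subtype.ext
  apply (isUnit_algebraMap_of_mem_nonZeroDivisors (Q := Q) hd).mul_right_cancel
  rw [ZeroMemClass.coe_zero, zero_mul]
  exact congrArg Subtype.val ht

instance isFractionRing : IsFractionRing S Q where
  map_units y := by
    obtain ⟨d, hd, r, hr⟩ := exists_mul_eq_algebraMap (A := R) ((y : S) : Q)
    have hrn : r ∈ R⁰ := by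
      rw [mem_nonZeroDivisors_iff_right]
      intro t ht
      have h1 : algebraMap R S t * y = 0 := by
        apply Subtype.ext
        apply (isUnit_algebraMap_of_mem_nonZeroDivisors (Q := Q) hd).mul_left_cancel
        change algebraMap R Q d * (algebraMap R Q t * (y : S)) = _ * 0
        rw [mul_left_comm, hr, ← map_mul, ht, map_zero, mul_zero]
      have h2 : algebraMap R S t = 0 := (mem_nonZeroDivisors_iff_right.1 y.2) _ h1
      exact IsFractionRing.injective R Q (by
        rw [map_zero]; exact congrArg Subtype.val h2)
    exact isUnit_of_mul_isUnit_right (hr ▸ isUnit_algebraMap_of_mem_nonZeroDivisors hrn)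
  surj q := by
    obtain ⟨d, hd, r, hr⟩ := exists_mul_eq_algebraMap (A := R) q
    exact ⟨(algebraMap R S r, ⟨algebraMap R S d, algebraMap_mem_nonZeroDivisors S hd⟩), by rw [mul_comm]; exact hr⟩
  exists_of_eq h := ⟨1, by rw [Subtype.ext h]⟩

variable {S} in
/-- Linear maps over `R` into torsion-free modules are `S`-linear. -/
lemma map_smul_of_torsionFree {M N : Type u} [AddCommGroup M] [Module R M] [Module S M]
    [IsScalarTower R S M] [AddCommGroup N] [Module R N] [Module S N] [IsScalarTower R S N]
    (hN : ∀ d ∈ R⁰, IsSMulRegular N d) (f : M →ₗ[R] N) (s : S) (m : M) : f (s • m) = s • f m := by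
  obtain ⟨d, hd, r, hr⟩ := exists_mul_eq_algebraMap (A := R) (s : Q)
  have hds : d • s = algebraMap R S r := Subtype.ext ((Algebra.smul_def d (s : Q)).trans hr)
  apply hN d hd
  change d • f (s • m) = d • (s • f m)
  rw [← map_smul, ← smul_assoc, ← smul_assoc, hds, algebraMap_smul, algebraMap_smul, map_smul]

lemma isSMulRegular_fractionRing (d : R) (hd : d ∈ R⁰) : IsSMulRegular Q d := fun a b h => by
  apply (isUnit_algebraMap_of_mem_nonZeroDivisors (Q := Q) hd).mul_left_cancel
  simpa only [Algebra.smul_def] using h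

/-- The conductor ideal of `R` and the conductor in `Q` agree. -/
noncomputable def birationalConductorEquiv : birationalConductor S ≃ₗ[R] conductor S :=
  LinearEquiv.ofBijective
    { toFun := fun r : birationalConductor S => ⟨algebraMap R Q r, (mem_birationalConductor S).1 r.2⟩
      map_add' := fun a b => Subtype.ext (map_add _ _ _)
      map_smul' := fun a b => Subtype.ext (by
        change algebraMap R Q (a * b) = a • algebraMap R Q b
        rw [map_mul, Algebra.smul_def]) }
    ⟨fun a b h => Subtype.ext (IsFractionRing.injective R Q (congrArg Subtype.val h)),
      fun c => by
        obtain ⟨r, hr⟩ := exists_algebraMap_eq S c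
        exact ⟨⟨r, (mem_birationalConductor S).2 (hr ▸ c.2)⟩, Subtype.ext hr⟩⟩

/-- Forms become `S`-linear once valued in `Q`, so values of forms on `S`-modules fall in the
conductor. -/
lemma algebraMap_dual_smul {M : Type u} [AddCommGroup M] [Module R M] [Module S M]
    [IsScalarTower R S M] (f : Module.Dual R M) (s : S) (m : M) :
    algebraMap R Q (f (s • m)) = algebraMap R Q (f m) * s := by
  have := map_smul_of_torsionFree (isSMulRegular_fractionRing (Q := Q))
    (Algebra.linearMap R Q ∘ₗ f) s m
  rw [mul_comm]
  exact this

lemma algebraMap_dual_mem_conductor {M : Type u} [AddCommGroup M] [Module R M] [Module S M]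
    [IsScalarTower R S M] (f : Module.Dual R M) (m : M) :
    algebraMap R Q (f m) ∈ conductor S := fun s => ⟨f (s • m), algebraMap_dual_smul S f s m⟩

/-- The dual of `S` is the conductor. -/
noncomputable def dualEquivConductor : Module.Dual R S ≃ₗ[R] conductor S :=
  LinearEquiv.ofBijective
    { toFun := fun f => ⟨algebraMap R Q (f 1), algebraMap_dual_mem_conductor S f 1⟩
      map_add' := fun a b => Subtype.ext (map_add _ _ _)
      map_smul' := fun a b => Subtype.ext (by
        change algebraMap R Q (a * b 1) = a • algebraMap R Q (b 1)
        rw [map_mul, Algebra.smul_def]) }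
    ⟨fun f g h => LinearMap.ext fun s => IsFractionRing.injective R Q (by
        have h1 : algebraMap R Q (f 1) = algebraMap R Q (g 1) := congrArg Subtype.val h
        have h2 := algebraMap_dual_smul S f s 1
        have h3 := algebraMap_dual_smul S g s 1
        rw [smul_eq_mul, mul_one] at h2 h3
        rw [h2, h3, h1]),
      fun c => by
        obtain ⟨g, hg⟩ := exists_linearMap_of_mem_range
          (LinearMap.mulLeft R (c : Q) ∘ₗ S.val.toLinearMap) (fun s => c.2 s)
        exact ⟨g, Subtype.ext ((hg 1).trans (mul_one _))⟩⟩

lemma moduleTrace_le {M : Type u} [AddCommGroup M] [Module R M] [Module S M]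
    [IsScalarTower R S M] : moduleTrace R M ≤ birationalConductor S := by
  refine iSup_le fun f => ?_
  rintro _ ⟨m, rfl⟩
  exact (mem_birationalConductor S).2 (algebraMap_dual_mem_conductor S f m)

lemma finite_conductor [IsNoetherianRing R] : Module.Finite S (conductor S) :=
  have : Module.Finite R (conductor S) := Module.Finite.equiv (birationalConductorEquiv S)
  Module.Finite.of_restrictScalars_finite R S (conductor S)

section Finite

variable [Module.Finite R S]

lemma exists_mem_birationalConductor : ∃ d ∈ birationalConductor S, d ∈ R⁰ := by
  obtain ⟨d, hd, g, hg⟩ := exists_clear_denominators (S.val.toLinearMap : S →ₗ[R] Q)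
  refine ⟨d, (mem_birationalConductor S).2 fun s => ⟨g s, ?_⟩, hd⟩
  rw [hg, Algebra.smul_def]; rfl

lemma exists_isUnit_mem_conductor : ∃ w : conductor S, IsUnit (w : Q) := by
  obtain ⟨d, hd, hd'⟩ := exists_mem_birationalConductor S
  exact ⟨⟨_, (mem_birationalConductor S).1 hd⟩, isUnit_algebraMap_of_mem_nonZeroDivisors hd'⟩

/-- A reflexive `S` is its own double dual in `Q`; the required unit in `S` is 1. -/
lemma mem_of_mul_conductor_subset [Module.IsReflexive R S] {a : Q}
    (ha : ∀ c ∈ conductor S, ∃ r : R, algebraMap R Q r = a * c) : a ∈ S := by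
  obtain ⟨s, rfl⟩ := exists_eq_of_isReflexive (A := R) (S.val.toLinearMap : S →ₗ[R] Q)
    Subtype.val_injective 1 (by simp) a (fun y hy => ha y hy)
  exact s.2

/-- If `S` is reflexive, then the endomorphism ring of the conductor is `S`. -/
noncomputable def equivEndConductor [Module.IsReflexive R S] :
    S ≃ₗ[R] (conductor S →ₗ[R] conductor S) :=
  LinearEquiv.ofBijective (Algebra.lsmul R R (conductor S) : S →ₐ[R] _).toLinearMap (by
    obtain ⟨w, hw⟩ := exists_isUnit_mem_conductor S
    constructor
    · intro s s' h
      have h1 : (s : Q) * w = s' * w := congrArg Subtype.val (LinearMap.congr_fun h w)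
      exact Subtype.ext (hw.mul_right_cancel h1)
    · intro f
      obtain ⟨u, hu⟩ := hw
      let j : conductor S →ₗ[R] Q := (conductor S).subtype.restrictScalars R
      have hfac : ∀ c : conductor S, (f c : Q) = (f w : Q) * ↑u⁻¹ * c := fun c => by
        have h1 : (f c : Q) * w = f w * c :=
          linearMap_mul_comm_of_injective j Subtype.val_injective (j ∘ₗ f) c w
        rw [mul_right_comm, ← h1, ← hu, Units.mul_inv_cancel_right]
      have hmem : (f w : Q) * ↑u⁻¹ ∈ S := mem_of_mul_conductor_subset S fun c hc => by
        obtain ⟨r, hr⟩ := exists_algebraMap_eq S (f ⟨c, hc⟩)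
        exact ⟨r, by rw [hr, hfac]⟩
      exact ⟨⟨_, hmem⟩, LinearMap.ext fun c => Subtype.ext (hfac c).symm⟩)

/-- If `S` is reflexive over `R` and the conductor is reflexive over `S`, then the conductor is an
invertible fractional ideal of `S`. -/
lemma conductor_mul_eq_one [Module.IsReflexive R S] [Module.IsReflexive S (conductor S)]
    {x : R} (h : IsOneDimParam R x) : conductor S * (1 / conductor S) = 1 := by
  have := h.isNoetherianRing
  have := finite_conductor S
  have hS := h.of_integral (algebraMap_mem_nonZeroDivisors S h.mem_nonZeroDivisors)
  have := hS.isNoetherianRing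
  let C := conductor S
  have hC : ∀ a : Q, (∀ b ∈ 1 / C, a * b ∈ S) → a ∈ C := by
    intro a ha
    obtain ⟨w, hw⟩ := exists_isUnit_mem_conductor S
    obtain ⟨c, rfl⟩ := exists_eq_of_isReflexive (A := S) C.subtype Subtype.val_injective w hw a
      (fun y hy => ⟨⟨a * y, ha y (Submodule.mem_div_iff_forall_mul_mem.2 fun c hc =>
        Submodule.mem_one.2 (hy ⟨c, hc⟩))⟩, rfl⟩)
    exact c.2
  have hle : C * (1 / C) ≤ 1 := Submodule.mul_one_div_le_one
  -- Otherwise `C * (1 / C)` lies in a maximal ideal `n`, which is minimal over `x` and so equals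
  -- `(xS : s)` for some `s`. The fraction `a = s/x` carries `n` into `S`, so `a * C * (1 / C) ⊆ S`.
  -- Reflexivity of `C` gives `a * C ⊆ C`, reflexivity of `S` gives `a ∈ S`, and then `s ∈ xS` puts
  -- 1 in `n`.
  by_contra hne
  let J : Ideal S := Submodule.comap (Algebra.linearMap S Q) (C * (1 / C))
  have hJ : J ≠ ⊤ := fun hJ => hne (le_antisymm hle (Submodule.one_le.2 (by
    have : (1 : S) ∈ J := hJ ▸ trivial
    exact this)))
  obtain ⟨n, hn, hJn⟩ := Ideal.exists_le_maximal J hJ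
  have hass : n ∈ associatedPrimes S (S ⧸ Ideal.span {algebraMap R S x}) := by
    apply Module.associatedPrimes.minimalPrimes_annihilator_subset_associatedPrimes
    rw [Ideal.annihilator_quotient]
    exact hS.mem_minimalPrimes_span n
  obtain ⟨-, z, hz⟩ := isAssociatedPrime_iff.1 hass
  obtain ⟨s, rfl⟩ := Ideal.Quotient.mk_surjective z
  have hmem : ∀ r, r ∈ n ↔ ∃ v, v * algebraMap R S x = r * s := by
    intro r
    rw [hz, Submodule.mem_colon_singleton, Submodule.mem_bot, ← Ideal.mem_span_singleton',
      ← Ideal.Quotient.eq_zero_iff_mem, map_mul]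
    rfl
  obtain ⟨u, hu⟩ := isUnit_algebraMap_of_mem_nonZeroDivisors (Q := Q) h.mem_nonZeroDivisors
  have hau : ∀ r v : S, v * algebraMap R S x = r * s → (s : Q) * ↑u⁻¹ * r = v := by
    intro r v hv
    have h1 : (v : Q) * u = r * s := by rw [hu]; exact congrArg Subtype.val hv
    rw [mul_right_comm, mul_comm (s : Q), ← h1, Units.mul_inv_cancel_right]
  have ha1 : ∀ c ∈ C, (s : Q) * ↑u⁻¹ * c ∈ C := by
    intro c hc
    refine hC _ fun b hb => mem_of_mul_conductor_subset S fun c' hc' => ?_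
    have hcb : c * b ∈ C * (1 / C) := Submodule.mul_mem_mul hc hb
    obtain ⟨r, hr⟩ := Submodule.mem_one.1 (hle hcb)
    have hrn : r ∈ n := hJn (by
      change algebraMap S Q r ∈ C * (1 / C)
      rw [hr]; exact hcb)
    obtain ⟨v, hv⟩ := (hmem r).1 hrn
    obtain ⟨r', hr'⟩ := hc' v
    refine ⟨r', ?_⟩
    have h2 : (r : Q) = c * b := hr
    rw [hr', ← hau r v hv, h2]; ring
  have ha2 : (s : Q) * ↑u⁻¹ ∈ S := mem_of_mul_conductor_subset S fun c hc => by
    obtain ⟨r, hr⟩ := exists_algebraMap_eq S ⟨_, ha1 c hc⟩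
    exact ⟨r, hr⟩
  refine hn.ne_top ((Ideal.eq_top_iff_one n).2 ((hmem 1).2 ⟨⟨_, ha2⟩, Subtype.ext ?_⟩))
  change (s : Q) * ↑u⁻¹ * algebraMap R Q x = 1 * s
  rw [← hu, Units.inv_mul_cancel_right, one_mul]

/-- An invertible fractional ideal of a ring with finitely many maximal ideals is principal. The
generator `g` divides a non-zero-divisor of `R`, hence is a unit of `Q`, and multiplication by it
gives `S ≅ C`. -/
theorem nonempty_equiv_dual_of_isReflexive [Module.IsReflexive R S]
    [Module.IsReflexive S (conductor S)] {x : R} (h : IsOneDimParam R x) :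
    Nonempty (S ≃ₗ[R] Module.Dual R S) := by
  have hS := h.of_integral (algebraMap_mem_nonZeroDivisors S h.mem_nonZeroDivisors)
  obtain ⟨d, hdI, hd⟩ := exists_mem_birationalConductor S
  have hdC := (mem_birationalConductor S).1 hdI
  let C : FractionalIdeal S⁰ Q := ⟨conductor S, 1, one_mem _, fun c hc => by
    obtain ⟨r, hr⟩ := exists_algebraMap_eq S ⟨c, hc⟩
    exact ⟨algebraMap R S r, by rw [one_smul]; exact hr⟩⟩
  let B : FractionalIdeal S⁰ Q := ⟨1 / conductor S, algebraMap R S d,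
    algebraMap_mem_nonZeroDivisors S hd, fun b hb => by
      obtain ⟨r, hr⟩ := Submodule.mem_one.1 (Submodule.mem_div_iff_forall_mul_mem.1 hb _ hdC)
      exact ⟨r, by rw [hr, mul_comm]; rfl⟩⟩
  have hCB : C * B = 1 := by
    apply FractionalIdeal.coeToSubmodule_injective
    change ((C * B : FractionalIdeal S⁰ Q) : Submodule S Q) = (1 : FractionalIdeal S⁰ Q)
    rw [FractionalIdeal.coe_mul, FractionalIdeal.coe_one]
    exact conductor_mul_eq_one S h
  obtain ⟨g, hg⟩ := FractionalIdeal.isPrincipal.of_finite_maximals_of_inv le_rfl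
    hS.finite_isMaximal C B hCB
  replace hg : conductor S = Submodule.span S {g} := hg
  have hgu : IsUnit g := by
    rw [hg] at hdC
    obtain ⟨s, hs⟩ := Submodule.mem_span_singleton.1 hdC
    have := isUnit_algebraMap_of_mem_nonZeroDivisors (Q := Q) hd
    rw [← hs, Subalgebra.smul_def, smul_eq_mul] at this
    exact isUnit_of_mul_isUnit_right this
  let e : S ≃ₗ[S] conductor S := LinearEquiv.ofBijective
    ((LinearMap.toSpanSingleton S Q g).codRestrict (conductor S) fun s => by
      rw [hg]; exact Submodule.smul_mem _ s (Submodule.mem_span_singleton_self g))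
    ⟨fun a b hab => Subtype.ext (hgu.mul_right_cancel (congrArg Subtype.val hab)), fun c => by
      obtain ⟨s, hs⟩ := Submodule.mem_span_singleton.1 (hg.le c.2)
      exact ⟨s, Subtype.ext hs⟩⟩
  exact ⟨(e.restrictScalars R).trans (dualEquivConductor S).symm⟩

end Finite

/-- Clearing denominators shows that `e` is `S`-linear, so `e 1` is a nondegenerate form and
represents every form on `S`. -/
theorem isReflexive_iff_of_equiv_dual (e : S ≃ₗ[R] Module.Dual R S) (M : Type u) [AddCommGroup M]
    [Module R M] [Module S M] [IsScalarTower R S M] :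
    Module.IsReflexive S M ↔ Module.IsReflexive R M := by
  have he : ∀ s u : S, e s u = e 1 (s * u) := by
    intro s u
    obtain ⟨d, hd, r, hr⟩ := exists_mul_eq_algebraMap (A := R) (s : Q)
    have hds : d • s = r • (1 : S) := Subtype.ext (by
      change d • (s : Q) = r • (1 : Q)
      rw [Algebra.smul_def, hr, Algebra.smul_def, mul_one])
    have h1 : d * e s u = d * e 1 (s * u) := by
      rw [← smul_eq_mul, ← LinearMap.smul_apply, ← map_smul, hds, map_smul, LinearMap.smul_apply,
        ← smul_eq_mul d, ← map_smul, ← map_smul, ← smul_mul_assoc, hds, smul_mul_assoc, one_mul]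
    exact (mul_cancel_left_mem_nonZeroDivisors hd).1 h1
  refine isReflexive_iff_of_traceForm (e 1) (fun s hs => ?_) (fun f => ⟨e.symm f, fun u => ?_⟩) M
  · apply e.injective
    rw [map_zero]
    exact LinearMap.ext fun u => by rw [he, hs]; rfl
  · rw [← he, LinearEquiv.apply_symm_apply]

/-- A reflexive module whose trace is contained in the conductor is a module over `S`. -/
theorem exists_module_of_moduleTrace_le (M : Type u) [AddCommGroup M] [Module R M]
    [Module.IsReflexive R M] (h : moduleTrace R M ≤ birationalConductor S) :
    ∃ _ : Module S M, IsScalarTower R S M := by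
  have hu : ∀ m m' : M, (∀ f : Module.Dual R M, algebraMap R Q (f m) = algebraMap R Q (f m')) →
      m = m' := fun m m' hm => (Module.bijective_dual_eval R M).1
    (LinearMap.ext fun f => IsFractionRing.injective R Q (hm f))
  -- The product `s • m` is the point representing `f ↦ f m * s` in the bidual; the trace condition
  -- keeps these values in `R`.
  have hex : ∀ (s : S) (m : M), ∃ m' : M, ∀ f : Module.Dual R M,
      algebraMap R Q (f m') = algebraMap R Q (f m) * s := by
    intro s m
    obtain ⟨φ, hφ⟩ := exists_linearMap_of_mem_range
      (LinearMap.mulRight R (s : Q) ∘ₗ Algebra.linearMap R Q ∘ₗ Module.Dual.eval R M m)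
      (fun f => (mem_birationalConductor S).1 (h (Submodule.mem_iSup_of_mem f ⟨m, rfl⟩)) s)
    obtain ⟨m', rfl⟩ := (Module.bijective_dual_eval R M).2 φ
    exact ⟨m', hφ⟩
  choose σ hσ using hex
  let inst : Module S M :=
    { smul := σ
      one_smul := fun m => hu _ _ fun f => by
        refine (hσ 1 m f).trans ?_
        rw [OneMemClass.coe_one, mul_one]
      mul_smul := fun s t m => hu _ _ fun f => by
        refine (hσ (s * t) m f).trans (Eq.trans ?_ (hσ s (σ t m) f).symm)
        rw [hσ, MulMemClass.coe_mul]; ring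
      smul_zero := fun s => hu _ _ fun f => by
        refine (hσ s 0 f).trans ?_
        rw [map_zero, map_zero, zero_mul]
      smul_add := fun s m m' => hu _ _ fun f => by
        refine (hσ s (m + m') f).trans (Eq.trans ?_ (congrArg (algebraMap R Q)
          (map_add f (σ s m) (σ s m')).symm))
        rw [map_add, map_add, map_add, hσ, hσ, add_mul]
      add_smul := fun s t m => hu _ _ fun f => by
        refine (hσ (s + t) m f).trans (Eq.trans ?_ (congrArg (algebraMap R Q)
          (map_add f (σ s m) (σ t m)).symm))
        rw [map_add, hσ, hσ, AddMemClass.coe_add, mul_add]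
      zero_smul := fun m => hu _ _ fun f => by
        refine (hσ 0 m f).trans ?_
        rw [ZeroMemClass.coe_zero, mul_zero, map_zero, map_zero] }
  refine ⟨inst, ⟨fun r s m => hu _ _ fun f => ?_⟩⟩
  refine (hσ (r • s) m f).trans (Eq.trans ?_ (congrArg (algebraMap R Q)
          (map_smul f r (σ s m)).symm))
  rw [smul_eq_mul, map_mul, hσ, Subalgebra.coe_smul, Algebra.smul_def]; ring

end BirationalExtension

/-! ### The implications between the conditions. -/

namespace BirationalExtension

variable {R Q : Type u} [CommRing R] [CommRing Q] [Algebra R Q] [IsFractionRing R Q]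
  (S : Subalgebra R Q)

lemma isReflModule_conductor [IsNoetherianRing R] [Module.IsReflexive R S] :
    IsReflModule R (conductor S) :=
  ⟨Module.Finite.equiv (birationalConductorEquiv S), Module.equiv (dualEquivConductor S)⟩

variable {S} in
-- The `S`-structure in (4) is only asserted to exist; uniqueness identifies it with the given one
-- on the conductor.
lemma module_eq_of_torsionFree {M : Type u} [AddCommGroup M] [Module R M]
    (hM : ∀ d ∈ R⁰, IsSMulRegular M d) (i₁ i₂ : Module S M)
    (h₁ : @IsScalarTower R S M _ i₁.toSMul _) (h₂ : @IsScalarTower R S M _ i₂.toSMul _) :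
    i₁ = i₂ :=
  Module.ext' i₁ i₂ fun s m =>
    @map_smul_of_torsionFree R Q _ _ _ S _ M M _ _ i₁ h₁ _ _ i₂ h₂ hM LinearMap.id s m

variable [Module.Finite R S] {x : R}

theorem isReflModule_iff_of_equiv_dual (h : IsOneDimParam R x) (e : S ≃ₗ[R] Module.Dual R S)
    (M : Type u) [AddCommGroup M] [Module R M] [Module S M] [IsScalarTower R S M] :
    IsReflModule S M ↔ IsMCM S M ∧ IsReflModule R M := by
  have hS := h.of_integral (algebraMap_mem_nonZeroDivisors S h.mem_nonZeroDivisors)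
  rw [hS.isMCM_iff]
  constructor
  · rintro ⟨hfin, hrefl⟩
    exact ⟨⟨hfin, hS.isSMulRegular_of_isReflexive M⟩, Module.Finite.trans S M,
      (isReflexive_iff_of_equiv_dual S e M).1 hrefl⟩
  · rintro ⟨⟨hfin, -⟩, -, hrefl⟩
    exact ⟨hfin, (isReflexive_iff_of_equiv_dual S e M).2 hrefl⟩

theorem exists_isReflModule_iff_of_equiv_dual (h : IsOneDimParam R x)
    (e : S ≃ₗ[R] Module.Dual R S) (M : Type u) [AddCommGroup M] [Module R M] :
    (∃ _ : Module S M, IsScalarTower R S M ∧ IsReflModule S M) ↔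
      IsReflModule R M ∧ moduleTrace R M ≤ birationalConductor S := by
  constructor
  · rintro ⟨_, _, hM⟩
    exact ⟨((isReflModule_iff_of_equiv_dual S h e M).1 hM).2, moduleTrace_le S⟩
  · rintro ⟨⟨hfin, hrefl⟩, htr⟩
    obtain ⟨_, _⟩ := exists_module_of_moduleTrace_le S M htr
    exact ⟨_, ‹_›, Module.Finite.of_restrictScalars_finite R S M,
      (isReflexive_iff_of_equiv_dual S e M).2 hrefl⟩

/-- Stability is the chain `C ≅ Hom_R(S, R) ≅ S ≅ End_R(C)`, whose last link needs `S` reflexive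
over `R`. -/
theorem isReflModule_and_isStableIdeal_of_equiv_dual (h : IsOneDimParam R x)
    (e : S ≃ₗ[R] Module.Dual R S) :
    IsReflModule R S ∧ IsStableIdeal (birationalConductor S) := by
  have hS : IsReflModule R S :=
    ((isReflModule_iff_of_equiv_dual S h e S).1 ⟨inferInstance, inferInstance⟩).2
  have := hS.2
  let eC := birationalConductorEquiv S
  exact ⟨hS, exists_mem_birationalConductor S,
    ⟨eC ≪≫ₗ (dualEquivConductor S).symm ≪≫ₗ e.symm ≪≫ₗ equivEndConductor S ≪≫ₗ
      LinearEquiv.arrowCongr eC.symm eC.symm⟩⟩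

theorem nonempty_equiv_dual_of_isStableIdeal [Module.IsReflexive R S]
    (h : IsStableIdeal (birationalConductor S)) : Nonempty (S ≃ₗ[R] Module.Dual R S) := by
  obtain ⟨-, ⟨e⟩⟩ := h
  let eC := birationalConductorEquiv S
  exact ⟨equivEndConductor S ≪≫ₗ LinearEquiv.arrowCongr eC.symm eC.symm ≪≫ₗ e.symm ≪≫ₗ eC ≪≫ₗ
    (dualEquivConductor S).symm⟩

/-- Testing `H` on `S` makes `S` reflexive over `R`. Then `C`, a dual of `S`, is reflexive over `R`,
and testing `H` on `C` makes it reflexive over `S`. -/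
theorem nonempty_equiv_dual_of_isReflModule_iff (h : IsOneDimParam R x)
    (H : ∀ (M : Type u) [AddCommGroup M] [Module R M] [Module S M] [IsScalarTower R S M],
      IsReflModule S M ↔ IsMCM S M ∧ IsReflModule R M) :
    Nonempty (S ≃ₗ[R] Module.Dual R S) := by
  have hS := h.of_integral (algebraMap_mem_nonZeroDivisors S h.mem_nonZeroDivisors)
  have := h.isNoetherianRing
  have := ((H S).1 ⟨inferInstance, inferInstance⟩).2.2
  have hC := isReflModule_conductor S
  have hreg : IsMCM S (conductor S) := by
    rw [hS.isMCM_iff]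
    have := hC.2
    refine ⟨finite_conductor S, fun a b hab => h.isSMulRegular_of_isReflexive (conductor S) ?_⟩
    simpa only [algebraMap_smul] using hab
  have := ((H (conductor S)).2 ⟨hreg, hC⟩).2
  exact nonempty_equiv_dual_of_isReflexive S h

theorem nonempty_equiv_dual_of_exists_isReflModule_iff (h : IsOneDimParam R x)
    (H : ∀ (M : Type u) [AddCommGroup M] [Module R M],
      (∃ _ : Module S M, IsScalarTower R S M ∧ IsReflModule S M) ↔
        IsReflModule R M ∧ moduleTrace R M ≤ birationalConductor S) :
    Nonempty (S ≃ₗ[R] Module.Dual R S) := by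
  have := h.isNoetherianRing
  have := ((H S).1 ⟨inferInstance, inferInstance, inferInstance, inferInstance⟩).1.2
  have htower : IsScalarTower R S (conductor S) := inferInstance
  obtain ⟨i, hi, hrefl⟩ := (H (conductor S)).2 ⟨isReflModule_conductor S, moduleTrace_le S⟩
  have hreg : ∀ d ∈ R⁰, IsSMulRegular (conductor S) d := fun d hd a b hab =>
    Subtype.ext (isSMulRegular_fractionRing d hd (congrArg Subtype.val hab))
  obtain rfl := module_eq_of_torsionFree hreg i (conductor S).module hi htower
  have := hrefl.2
  exact nonempty_equiv_dual_of_isReflexive S h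

end BirationalExtension

/-! ### The main theorem. -/

open BirationalExtension

theorem theorem3p5 {R Q : Type u} [CommRing R] [IsLocalRing R] [CommRing Q] [Algebra R Q]
    [IsFractionRing R Q]
    (hCM : IsCohenMacaulayLocal R) (hdim : ringKrullDim R = 1) (hGor : IsGenericallyGorenstein R)
    (S : Subalgebra R Q) (hfin : Module.Finite R S) :
    List.TFAE [
      -- (1) `ΩCM(S) = CM(S) ∩ ΩCM(R)`
      ∀ (M : Type u) [AddCommGroup M] [Module R M] [Module S M] [IsScalarTower R S M],
        IsSyzygyMCM S M ↔ IsMCM S M ∧ IsSyzygyMCM R M,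
      -- (2) `S ≅ Hom_R(S, R)`
      Nonempty (S ≃ₗ[R] Module.Dual R S),
      -- (3) `S ∈ refl(R)` and the conductor is stable
      IsReflModule R S ∧ IsStableIdeal (birationalConductor S),
      -- (4) `ΩCM(S) = {M ∈ refl(R) : tr_R(M) ⊆ 𝔠_R(S)}`, as classes of `R`-modules
      ∀ (M : Type u) [AddCommGroup M] [Module R M],
        (∃ _ : Module S M, IsScalarTower R S M ∧ IsSyzygyMCM S M) ↔
          IsReflModule R M ∧ moduleTrace R M ≤ birationalConductor S,
      -- (1) with `refl` in place of `ΩCM`: `refl(S) = CM(S) ∩ refl(R)`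
      ∀ (M : Type u) [AddCommGroup M] [Module R M] [Module S M] [IsScalarTower R S M],
        IsReflModule S M ↔ IsMCM S M ∧ IsReflModule R M] ∧
    -- `ΩCM(R) = refl(R)`
    (∀ (M : Type u) [AddCommGroup M] [Module R M], IsSyzygyMCM R M ↔ IsReflModule R M) ∧
    -- `ΩCM(S) = refl(S)`
    (∀ (M : Type u) [AddCommGroup M] [Module S M], IsSyzygyMCM S M ↔ IsReflModule S M) := by
  obtain ⟨x, h⟩ := hCM.exists_isOneDimParam hdim
  have hS := h.of_integral (algebraMap_mem_nonZeroDivisors S h.mem_nonZeroDivisors)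
  have : Module.Injective Q Q := h.injective_fractionRing hGor
  have hR : ∀ (M : Type u) [AddCommGroup M] [Module R M], IsSyzygyMCM R M ↔ IsReflModule R M :=
    fun M _ _ => h.isSyzygyMCM_iff_isReflModule Q M
  have hS' : ∀ (M : Type u) [AddCommGroup M] [Module S M], IsSyzygyMCM S M ↔ IsReflModule S M :=
    fun M _ _ => hS.isSyzygyMCM_iff_isReflModule Q M
  refine ⟨?_, hR, hS'⟩
  -- With syzygies replaced by reflexive modules, (1) becomes literally (5), and (4) concerns
  -- reflexive `S`-modules.
  simp only [hR, hS']
  tfae_have 1 ↔ 5 := Iff.rfl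
  tfae_have 2 → 5 := fun ⟨e⟩ M _ _ _ _ => isReflModule_iff_of_equiv_dual S h e M
  tfae_have 5 → 2 := fun H => nonempty_equiv_dual_of_isReflModule_iff S h H
  tfae_have 2 → 4 := fun ⟨e⟩ M _ _ => exists_isReflModule_iff_of_equiv_dual S h e M
  tfae_have 4 → 2 := fun H => nonempty_equiv_dual_of_exists_isReflModule_iff S h H
  tfae_have 2 → 3 := fun ⟨e⟩ => isReflModule_and_isStableIdeal_of_equiv_dual S h e
  tfae_have 3 → 2 := fun ⟨h1, h2⟩ => have := h1.2; nonempty_equiv_dual_of_isStableIdeal S h2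
  tfae_finish
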